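/- Let $q$ be an odd prime power, let $\mathbf{F}_q$ be the field with $q$ elements, and let $n,k,s\ge 0$ be integers with $k\le n$. A symmetric $m\times m$ matrix $A$ of rank $r>0$ over $\mathbf{F}_q$ has (quadratic) character $+$ if $A=M\,\mathrm{diag}(1^{r},0^{m-r})\,M^{T}$ for some $M\in \mathbf{GL}(m,q)$, and character $-$ if $A=M\,\mathrm{diag}(1^{r-1},z,0^{m-r})\,M^{T}$ for some non-square $z\in\mathbf{F}_q$ and some $M\in\mathbf{GL}(m,q)$; the zero matrix has character $+$. Let $\mathrm{sym}(m,r)$ be the number of $m\times m$ symmetric matrices of rank $r$ over $\mathbf{F}_q$, let $\mathrm{sym}_0(m,j,r)$ be the number of those whose first $j$ diagonal entries are zero (with no other restriction), and let $\mathrm{sym}_0^{\pm}(m,j,r)$ be the number of the latter that have character $\pm$. Then $$\mathrm{sym}_0^{+}(n+1,k+1,2s+1)=\mathrm{sym}_0^{-}(n+1,k+1,2s+1)=\tfrac12\,\mathrm{sym}_0(n+1,k+1,2s+1)$$ and $$\mathrm{sym}_0(n+1,k+1,2s)+\mathrm{sym}_0(n+1,k+1,2s+1)=\frac{1}{q^{k+1}}\bigl(\mathrm{sym}(n+1,2s)+\mathrm{sym}(n+1,2s+1)\bigr).$$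 -/

import Mathlib

namespace SymRank

/-- The diagonal matrix `diag(1, …, 1, δ, 0, …, 0)` of size `n`, with `r - 1` ones followed by `δ`
and `n - r` zeros when `0 < r ≤ n`; it is the zero matrix when `r = 0`. -/
def normalForm (F : Type*) [Field F] (n r : ℕ) (δ : F) : Matrix (Fin n) (Fin n) F :=
  Matrix.diagonal fun i => if i.val + 1 < r then 1 else if i.val + 1 = r then δ else 0

/-- `A` has quadratic character `+`: `A = M * diag(1^r, 0^(n-r)) * Mᵀ` for some invertible `M`, with
`r` the rank of `A`. For `r = 0` this holds, by the convention that the zero matrix has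
character `+`. -/
def HasPlusCharacter {F : Type*} [Field F] {n : ℕ} (A : Matrix (Fin n) (Fin n) F) : Prop :=
  ∃ M : Matrix.GeneralLinearGroup (Fin n) F,
    A = M.val * normalForm F n A.rank 1 * M.val.transpose

/-- `A` has quadratic character `-`: its rank `r` is positive, and
`A = M * diag(1^(r-1), z, 0^(n-r)) * Mᵀ` for some non-square `z` and some invertible `M`. -/
def HasMinusCharacter {F : Type*} [Field F] {n : ℕ} (A : Matrix (Fin n) (Fin n) F) : Prop :=
  0 < A.rank ∧ ∃ z : F, ¬ IsSquare z ∧ ∃ M : Matrix.GeneralLinearGroup (Fin n) F,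
    A = M.val * normalForm F n A.rank z * M.val.transpose

/-- The set of `n × n` symmetric matrices of rank `r` over `F`. -/
def Sym (F : Type*) [Field F] (n r : ℕ) : Set (Matrix (Fin n) (Fin n) F) :=
  {A | A.IsSymm ∧ A.rank = r}

/-- The set of `n × n` symmetric matrices of rank `r` over `F` whose first `k` diagonal entries
are zero, with no other restriction. -/
def Sym0 (F : Type*) [Field F] (n k r : ℕ) : Set (Matrix (Fin n) (Fin n) F) :=
  {A | A.IsSymm ∧ A.rank = r ∧ ∀ i : Fin n, i.val < k → A i i = 0}

/-- `sym(n, r)`. -/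
noncomputable def sym (F : Type*) [Field F] (n r : ℕ) : ℕ :=
  (Sym F n r).ncard

/-- `sym₀(n, k, r)`. -/
noncomputable def sym0 (F : Type*) [Field F] (n k r : ℕ) : ℕ :=
  (Sym0 F n k r).ncard

/-- `sym₀⁺(n, k, r)`: the matrices counted by `sym₀(n, k, r)` that have character `+`. -/
noncomputable def sym0Plus (F : Type*) [Field F] (n k r : ℕ) : ℕ :=
  {A | A ∈ Sym0 F n k r ∧ HasPlusCharacter A}.ncard

/-- `sym₀⁻(n, k, r)`: the matrices counted by `sym₀(n, k, r)` that have character `-`. -/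
noncomputable def sym0Minus (F : Type*) [Field F] (n k r : ℕ) : ℕ :=
  {A | A ∈ Sym0 F n k r ∧ HasMinusCharacter A}.ncard

end SymRank

/-! Characters. Over a finite field of odd characteristic every symmetric matrix is congruent to
`diag(1, …, 1, δ, 0, …, 0)`, with `δ` well defined modulo squares. Scaling by a non-square `z` keeps
rank, symmetry and zero diagonal entries, and multiplies `δ` by `z ^ r` up to squares. For odd `r`
this swaps the two characters, so both classes have the same size.

Ranks. The pair `2s`, `2s + 1` is the condition `rank / 2 = s`, and it suffices that each further
zero on the diagonal divides the count by `q` (`card_pairSet_insert`). Fix the block `B` that omits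
that index; only a border `(v, a)` varies. It raises the rank by 2 if `v` is outside the column
space of `B`; if `v = B u`, it raises it by 0 or 1 according to whether `a = v ⬝ u`. For `B` of even
rank, `rank / 2` does not depend on `a`. For odd rank, it depends only on whether the rank is
unchanged, so among the borders leaving the rank unchanged a fraction `1 / q` must have `a = 0`.
Since `v ⬝ u = uᵀ B u`, this says that a quadratic form of odd rank has as many zeros as a
hyperplane (`card_mul_zeroCount_of_odd`), again proved by scaling with a non-square. -/

namespace SymRank

open Matrix

variable {F : Type*} [Field F]

/-! ### Congruence and diagonalization -/

section Congruence

/-- Every symmetric matrix is congruent to a diagonal one. -/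
theorem exists_eq_mul_diagonal_mul_transpose {ι : Type*} [Fintype ι] [DecidableEq ι]
    (h2 : (2 : F) ≠ 0) {A : Matrix ι ι F} (hA : A.IsSymm) :
    ∃ (M : GL ι F) (w : ι → F), A = M.val * diagonal w * M.val.transpose := by
  have : Invertible (2 : F) := invertibleOfNonzero h2
  have hs : LinearMap.IsSymm (Matrix.toBilin' A) := by
    constructor
    intro x y
    rw [Matrix.toBilin'_apply', Matrix.toBilin'_apply', dotProduct_mulVec, ← mulVec_transpose,
      hA.eq, dotProduct_comm]
    rfl
  obtain ⟨v, hv⟩ := LinearMap.BilinForm.exists_orthogonal_basis hs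
  have e : Fin (Module.finrank F (ι → F)) ≃ ι :=
    Fintype.equivOfCardEq (by simp)
  let b := v.reindex e
  let P := b.toMatrix (Pi.basisFun F ι)
  have h1 := LinearMap.BilinForm.toMatrix_mul_basis_toMatrix b (Pi.basisFun F ι) (Matrix.toBilin' A)
  have h3 : LinearMap.BilinForm.toMatrix (Pi.basisFun F ι) (Matrix.toBilin' A) = A := by
    rw [LinearMap.BilinForm.toMatrix_basisFun, LinearMap.BilinForm.toMatrix'_toBilin']
  have h4 : LinearMap.BilinForm.toMatrix b (Matrix.toBilin' A)
      = diagonal fun i => Matrix.toBilin' A (b i) (b i) := by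
    ext i j
    rw [LinearMap.BilinForm.toMatrix_apply]
    by_cases hij : i = j
    · subst hij; simp
    · rw [diagonal_apply_ne _ hij]
      have : e.symm i ≠ e.symm j := fun h => hij (e.symm.injective h)
      simpa [b] using hv this
  rw [h3, h4] at h1
  have hP : IsUnit P := ⟨⟨P, (Pi.basisFun F ι).toMatrix b, b.toMatrix_mul_toMatrix_flip _,
    Module.Basis.toMatrix_mul_toMatrix_flip _ _⟩, rfl⟩
  obtain ⟨u, hu⟩ := (isUnit_transpose P).2 hP
  refine ⟨u, fun i => Matrix.toBilin' A (b i) (b i), ?_⟩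
  rw [hu, transpose_transpose]
  exact h1.symm

/-- Two matrices are congruent when `A = M * B * Mᵀ` for an invertible `M`. -/
def Congr {ι : Type*} [Fintype ι] [DecidableEq ι] (A B : Matrix ι ι F) : Prop :=
  ∃ M : GL ι F, A = M.val * B * M.val.transpose

variable {ι : Type*} [Fintype ι] [DecidableEq ι]

theorem Congr.refl (A : Matrix ι ι F) : Congr A A := ⟨1, by simp⟩

theorem Congr.symm {A B : Matrix ι ι F} (h : Congr A B) : Congr B A := by
  obtain ⟨M, rfl⟩ := h
  refine ⟨M⁻¹, ?_⟩
  have h1 : (M⁻¹).val * M.val = 1 := by rw [← Units.val_mul]; simp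
  have h2 : M.val.transpose * (M⁻¹).val.transpose = 1 := by
    rw [← transpose_mul, h1, transpose_one]
  calc B = (M⁻¹.val * M.val) * B * (M.val.transpose * M⁻¹.val.transpose) := by rw [h1, h2]; simp
    _ = _ := by simp only [Matrix.mul_assoc]

theorem Congr.trans {A B C : Matrix ι ι F} (h : Congr A B) (h' : Congr B C) : Congr A C := by
  obtain ⟨M, rfl⟩ := h
  obtain ⟨N, rfl⟩ := h'
  exact ⟨M * N, by simp only [Units.val_mul, transpose_mul, Matrix.mul_assoc]⟩

theorem Congr.smul {A B : Matrix ι ι F} (c : F) (h : Congr A B) : Congr (c • A) (c • B) := by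
  obtain ⟨M, rfl⟩ := h
  exact ⟨M, by simp⟩

theorem Congr.rank_eq {A B : Matrix ι ι F} (h : Congr A B) : A.rank = B.rank := by
  obtain ⟨M, rfl⟩ := h
  have hM : IsUnit M.val.det := (isUnit_iff_isUnit_det _).1 M.isUnit
  rw [rank_mul_eq_left_of_isUnit_det _ _ (by rwa [det_transpose]),
    rank_mul_eq_right_of_isUnit_det _ _ hM]

theorem congr_of_det_ne_zero {A B M : Matrix ι ι F} (hM : M.det ≠ 0) (h : M * B * Mᵀ = A) :
    Congr A B :=
  ⟨GeneralLinearGroup.mkOfDetNeZero M hM, h.symm⟩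

theorem congr_diagonal_comp (w : ι → F) (σ : Equiv.Perm ι) :
    Congr (diagonal (w ∘ σ)) (diagonal w) := by
  refine congr_of_det_ne_zero (M := (1 : Matrix ι ι F).submatrix σ id) ?_ ?_
  · rw [det_permute]
    rcases Int.units_eq_one_or (Equiv.Perm.sign σ) with h | h <;> simp [h]
  · ext i j
    by_cases hij : i = j <;>
      simp [Matrix.mul_apply, diagonal_apply, Matrix.one_apply, σ.injective.eq_iff, hij]

theorem congr_diagonal_smul_sq (w c : ι → F) (hc : ∀ i, c i ≠ 0) :
    Congr (diagonal fun i => c i ^ 2 * w i) (diagonal w) := by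
  refine congr_of_det_ne_zero (M := diagonal c) ?_ ?_
  · rw [det_diagonal]; exact Finset.prod_ne_zero_iff.2 fun i _ => hc i
  · rw [diagonal_transpose, diagonal_mul_diagonal, diagonal_mul_diagonal]
    congr 1; ext i; ring

/-- The matrix of the substitution `eᵢ ↦ x eᵢ + y eⱼ`, `eⱼ ↦ -b y eᵢ + a x eⱼ`. -/
def planeMatrix (i j : ι) (a b x y : F) : Matrix ι ι F := fun p =>
  if p = i then Pi.single i x + Pi.single j y
  else if p = j then Pi.single i (-(b * y)) + Pi.single j (a * x) else Pi.single p 1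

/-- The vector `x eᵢ + y eⱼ` has norm 1 by `h`; `-b y eᵢ + a x eⱼ` is orthogonal to it and has norm
`a b (a x² + b y²) = a b`. -/
theorem planeMatrix_mul_diagonal {i j : ι} (hij : i ≠ j) {a b x y : F}
    (h : a * x ^ 2 + b * y ^ 2 = 1) {w : ι → F} (hi : w i = a) (hj : w j = b) :
    planeMatrix i j a b x y * diagonal w * (planeMatrix i j a b x y)ᵀ =
      diagonal (Function.update (Function.update w i 1) j (a * b)) := by
  have key : ∀ p q, (planeMatrix i j a b x y * diagonal w * (planeMatrix i j a b x y)ᵀ) p q =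
      ∑ k, planeMatrix i j a b x y p k * (w k * planeMatrix i j a b x y q k) := by
    intro p q
    simp [Matrix.mul_apply, diagonal_apply, mul_assoc]
  ext p q
  rw [key]
  have e1 : ∀ (s t : ι) (c d : F) (g : ι → F),
      ∑ k, ((Pi.single s c + Pi.single t d : ι → F) k) * g k = c * g s + d * g t := by
    intro s t c d g
    simp [add_mul, Finset.sum_add_distrib, Pi.single_apply]
  have e2 : ∀ (s : ι) (c : F) (g : ι → F),
      ∑ k, (Pi.single s c : ι → F) k * g k = c * g s := by
    intro s c g
    simp [Pi.single_apply]
  have hji := hij.symm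
  rcases eq_or_ne p i with rfl | hpi
  · have : planeMatrix p j a b x y p = Pi.single p x + Pi.single j y := by simp [planeMatrix]
    rw [this, e1]
    rcases eq_or_ne q p with rfl | hq
    · rw [this]; simp [hij, hij.symm, hi, hj]; linear_combination h
    · rw [diagonal_apply_ne _ hq.symm]
      rcases eq_or_ne q j with rfl | hqj
      · simp [planeMatrix, hij, hij.symm, hi, hj]; ring
      · simp [planeMatrix, hq, hqj, hq.symm, hqj.symm]
  rcases eq_or_ne p j with rfl | hpj
  · have : planeMatrix i p a b x y p = Pi.single i (-(b * y)) + Pi.single p (a * x) := by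
      simp [planeMatrix, hpi]
    rw [this, e1]
    rcases eq_or_ne q p with rfl | hq
    · rw [this]; simp [hij, hij.symm, hi, hj]; linear_combination a * b * h
    · rw [diagonal_apply_ne _ hq.symm]
      rcases eq_or_ne q i with rfl | hqj
      · simp [planeMatrix, hij, hij.symm, hi, hj]; ring
      · simp [planeMatrix, hq, hqj, hq.symm, hqj.symm]
  have : planeMatrix i j a b x y p = Pi.single p 1 := by simp [planeMatrix, hpi, hpj]
  rw [this, e2]
  rcases eq_or_ne q p with rfl | hq
  · rw [this]; simp [hpi, hpj]
  · rw [diagonal_apply_ne _ hq.symm]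
    rcases eq_or_ne q i with rfl | hqi
    · simp [planeMatrix, hpi, hpj]
    rcases eq_or_ne q j with rfl | hqj
    · simp [planeMatrix, hpi, hpj, hqi]
    · simp [planeMatrix, hqi, hqj, hq.symm]

theorem congr_diagonal_plane {i j : ι} (hij : i ≠ j) {x y : F} {w : ι → F} (hi : w i ≠ 0)
    (hj : w j ≠ 0) (h : w i * x ^ 2 + w j * y ^ 2 = 1) :
    Congr (diagonal (Function.update (Function.update w i 1) j (w i * w j))) (diagonal w) := by
  refine congr_of_det_ne_zero ?_ (planeMatrix_mul_diagonal hij h rfl rfl)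
  -- Invertibility comes from the same identity, applied to the form with all other coefficients 1:
  -- the right side then has nonzero determinant.
  have := planeMatrix_mul_diagonal hij h
    (w := Function.update (Function.update 1 i (w i)) j (w j)) (by simp [hij]) (by simp)
  intro h0
  have h1 := congrArg det this
  rw [det_mul, det_mul, h0, zero_mul, zero_mul, det_diagonal] at h1
  refine Finset.prod_ne_zero_iff.2 (fun k _ => ?_) h1.symm
  rcases eq_or_ne k j with rfl | hkj
  · simp [hi, hj]
  rcases eq_or_ne k i with rfl | hki
  · simp [hij]
  · simp [hkj, hki]

end Congruence

/-! ### Normal form and discriminant -/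

section Classification

/-- Over a finite field of odd characteristic a nondegenerate binary form represents `1`. -/
theorem exists_mul_sq_add_mul_sq_eq_one [Finite F] (h2 : ringChar F ≠ 2) {a b : F} (ha : a ≠ 0)
    (hb : b ≠ 0) : ∃ x y : F, a * x ^ 2 + b * y ^ 2 = 1 := by
  have := Fintype.ofFinite F
  obtain ⟨x, y, h⟩ := FiniteField.exists_root_sum_quadratic
    (f := Polynomial.C a * Polynomial.X ^ 2) (g := Polynomial.C b * Polynomial.X ^ 2 - 1)
    (Polynomial.degree_C_mul_X_pow 2 ha)
    (by
      rw [show (1 : Polynomial F) = Polynomial.C 1 by simp,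
        Polynomial.degree_sub_C (by rw [Polynomial.degree_C_mul_X_pow 2 hb]; norm_num),
        Polynomial.degree_C_mul_X_pow 2 hb]; rfl)
    (FiniteField.odd_card_of_char_ne_two h2)
  exact ⟨x, y, by simp at h; linear_combination h⟩

/-- A diagonal matrix can be sorted so that its nonzero entries come first. -/
theorem exists_perm_ne_zero_iff_lt {n : ℕ} [DecidableEq F] (w : Fin n → F) :
    ∃ σ : Equiv.Perm (Fin n), ∀ i,
      w (σ i) ≠ 0 ↔ i.val < Fintype.card {i // w i ≠ 0} := by
  have hle : Fintype.card {i // w i ≠ 0} ≤ n := by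
    simpa only [Fintype.card_fin] using Fintype.card_subtype_le (fun i => w i ≠ 0)
  have e : {i : Fin n // i.val < Fintype.card {i // w i ≠ 0}} ≃ {i // w i ≠ 0} :=
    Fintype.equivOfCardEq (by
      rw [Fintype.card_subtype, Fin.card_filter_val_lt]; exact min_eq_right hle)
  refine ⟨e.extendSubtype, fun i => ?_⟩
  by_cases h : i.val < Fintype.card {i // w i ≠ 0}
  · simp only [h, iff_true]; exact e.extendSubtype_mem i h
  · simp only [h, iff_false]; exact e.extendSubtype_not_mem i h

/-- A plane substitution at positions `j`, `j + 1` makes the first entry 1 and moves the product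
into the second. The bound `j + 1 ≤ r` leaves the last nonzero entry to absorb the discriminant. -/
theorem exists_congr_diagonal_prefix_one [Finite F] (h2 : ringChar F ≠ 2) {n r : ℕ} (hr : r ≤ n)
    {w : Fin n → F} (hw : ∀ i, w i ≠ 0 ↔ i.val < r) (j : ℕ) (hj : j + 1 ≤ r) :
    ∃ w' : Fin n → F, Congr (diagonal w) (diagonal w') ∧ (∀ i, w' i ≠ 0 ↔ i.val < r) ∧
      ∀ i, i.val < j → w' i = 1 := by
  induction j with
  | zero => exact ⟨w, Congr.refl _, hw, by simp⟩
  | succ j ih =>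
    obtain ⟨v, hv, hv0, hv1⟩ := ih (by omega)
    let a : Fin n := ⟨j, by omega⟩
    let b : Fin n := ⟨j + 1, by omega⟩
    have hab : a ≠ b := by simp [a, b]
    have ha : v a ≠ 0 := (hv0 a).2 (by simp only [a]; omega)
    have hb : v b ≠ 0 := (hv0 b).2 (by simp only [b]; omega)
    obtain ⟨x, y, h⟩ := exists_mul_sq_add_mul_sq_eq_one h2 ha hb
    refine ⟨_, hv.trans (congr_diagonal_plane hab ha hb h).symm, fun i => ?_, fun i hi => ?_⟩
    · rcases eq_or_ne i b with rfl | hib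
      · simp [ha, hb, ← hv0]
      rcases eq_or_ne i a with rfl | hia
      · simp [hab, ← hv0, ha]
      · simp [hib, hia, ← hv0]
    · have hib : i ≠ b := by
        rintro rfl; simp [b] at hi
      rcases eq_or_ne i a with rfl | hia
      · simp [hab]
      · have : i.val ≠ j := fun h => hia (Fin.ext h)
        simp [hib, hia, hv1 i (by omega)]

/-- A symmetric matrix over a finite field of odd characteristic is congruent to
`diag(1, …, 1, δ, 0, …, 0)`. -/
theorem exists_congr_normalForm [Finite F] (h2 : ringChar F ≠ 2) {n : ℕ}
    {A : Matrix (Fin n) (Fin n) F} (hA : A.IsSymm) :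
    ∃ δ : F, δ ≠ 0 ∧ Congr A (normalForm F n A.rank δ) := by
  classical
  obtain ⟨M, w, hM⟩ := exists_eq_mul_diagonal_mul_transpose (Ring.two_ne_zero h2) hA
  have hAw : Congr A (diagonal w) := ⟨M, hM⟩
  have hr : A.rank = Fintype.card {i // w i ≠ 0} := by rw [hAw.rank_eq, rank_diagonal]
  obtain ⟨σ, hσ⟩ := exists_perm_ne_zero_iff_lt w
  rw [← hr] at hσ
  have hAσ := hAw.trans (congr_diagonal_comp w σ).symm
  have hle : A.rank ≤ n := by simpa using A.rank_le_card_width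
  rcases Nat.eq_zero_or_pos A.rank with h0 | hpos
  · refine ⟨1, one_ne_zero, ?_⟩
    convert hAσ using 1
    rw [h0] at hσ ⊢
    simp only [normalForm]
    congr 1; ext i
    have := hσ i
    simp at this
    simp [this]
  · obtain ⟨v, hv, hv0, hv1⟩ := exists_congr_diagonal_prefix_one h2 hle hσ (A.rank - 1) (by omega)
    refine ⟨v ⟨A.rank - 1, by omega⟩, (hv0 _).2 (by simp; omega), ?_⟩
    convert hAσ.trans hv using 1
    simp only [normalForm]
    congr 1; ext i
    split_ifs with h1 h2
    · exact (hv1 i (by omega)).symm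
    · congr 1; ext; simp; omega
    · exact (not_not.1 ((hv0 i).not.2 (by omega))).symm

theorem normalForm_congr_one_of_isSquare {n r : ℕ} {δ : F} (hδ : δ ≠ 0) (h : IsSquare δ) :
    Congr (normalForm F n r δ) (normalForm F n r 1) := by
  obtain ⟨c, rfl⟩ := h
  have := congr_diagonal_smul_sq (fun i : Fin n => if i.val + 1 < r then 1 else
    if i.val + 1 = r then (1 : F) else 0) (fun i => if i.val + 1 = r then c else 1)
    (fun i => by
      have : c ≠ 0 := by rintro rfl; simp at hδ
      split_ifs <;> simp [this])
  convert this using 1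
  · simp only [normalForm]
    congr 1; ext i
    split_ifs <;> first | omega | ring
  · rfl

/-- The discriminant of a form of rank `r`, scaled by `c`, is well defined up to squares. -/
theorem exists_pow_mul_eq_sq_mul {n r : ℕ} (hr : r + 1 ≤ n) {c δ δ' : F}
    (h : Congr (c • normalForm F n (r + 1) δ) (normalForm F n (r + 1) δ')) :
    ∃ d : F, c ^ (r + 1) * δ = d ^ 2 * δ' := by
  obtain ⟨P, hP⟩ := h
  let f : Fin (r + 1) → Fin n := Fin.castLE hr
  have hf : Function.Injective f := Fin.castLE_injective hr
  let w : F → Fin n → F := fun δ i =>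
    if i.val + 1 < r + 1 then 1 else if i.val + 1 = r + 1 then δ else 0
  have hdet : ∀ δ, (diagonal (w δ ∘ f)).det = δ := by
    intro δ
    rw [det_diagonal, Fin.prod_univ_castSucc]
    simp [w, f]
  have hsub : ∀ δ, (normalForm F n (r + 1) δ).submatrix f f = diagonal (w δ ∘ f) := by
    intro δ
    exact submatrix_diagonal _ f hf
  -- The normal form vanishes outside its leading block of size `r + 1`, so the congruence restricts
  -- to leading blocks, where determinants can be compared.
  have h1 : c • diagonal (w δ ∘ f) =
      P.val.submatrix f f * diagonal (w δ' ∘ f) * (P.val.submatrix f f)ᵀ := by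
    rw [← hsub, show c • (normalForm F n (r + 1) δ).submatrix f f =
      (c • normalForm F n (r + 1) δ).submatrix f f from rfl, hP]
    ext p q
    rw [submatrix_apply, Matrix.mul_apply, Matrix.mul_apply]
    simp only [normalForm, submatrix_apply, mul_diagonal, transpose_apply, Function.comp]
    refine (Fintype.sum_of_injective f hf _ _ (fun k hk => ?_) fun k => rfl).symm
    have : ¬ k.val < r + 1 := fun h => hk ⟨⟨k.val, h⟩, rfl⟩
    rw [if_neg (by omega), if_neg (by omega)]
    simp
  have h2 := congrArg det h1
  rw [det_smul, det_mul, det_mul, det_transpose, hdet, hdet, Fintype.card_fin] at h2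
  exact ⟨(P.val.submatrix f f).det, by rw [h2]; ring⟩

theorem isSquare_mul_of_not_isSquare [Finite F] {a b : F} (ha : ¬ IsSquare a)
    (hb : ¬ IsSquare b) : IsSquare (a * b) := by
  classical
  have := Fintype.ofFinite F
  by_cases h0 : a * b = 0
  · rw [h0]; exact IsSquare.zero
  rw [← quadraticChar_one_iff_isSquare h0, map_mul, quadraticChar_neg_one_iff_not_isSquare.2 ha,
    quadraticChar_neg_one_iff_not_isSquare.2 hb]
  norm_num

end Classification

/-! ### Characters under scaling -/

section Character

variable {n : ℕ} {A : Matrix (Fin n) (Fin n) F}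

theorem hasPlusCharacter_or_hasMinusCharacter [Finite F] (h2 : ringChar F ≠ 2) (hA : A.IsSymm)
    (hr : 0 < A.rank) : HasPlusCharacter A ∨ HasMinusCharacter A := by
  obtain ⟨δ, hδ, h⟩ := exists_congr_normalForm h2 hA
  by_cases hs : IsSquare δ
  · exact Or.inl (h.trans (normalForm_congr_one_of_isSquare hδ hs))
  · exact Or.inr ⟨hr, δ, hs, h⟩

/-- Used with `c = 1` to show that the characters exclude each other, and with `c` a non-square to
show that scaling swaps them in odd rank. -/
theorem exists_pow_rank_mul_eq {c δ δ' : F} (hc : c ≠ 0) (hr : 0 < A.rank)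
    (h : Congr A (normalForm F n A.rank δ))
    (h' : Congr (c • A) (normalForm F n (c • A).rank δ')) :
    ∃ d : F, c ^ A.rank * δ = d ^ 2 * δ' := by
  have hle : A.rank ≤ n := by simpa using A.rank_le_card_width
  rw [rank_smul_of_mem_nonZeroDivisors _ (mem_nonZeroDivisors_of_ne_zero hc)] at h'
  have := (h.smul c).symm.trans h'
  obtain ⟨r, hr'⟩ : ∃ r, A.rank = r + 1 := ⟨A.rank - 1, by omega⟩
  rw [hr'] at this hle ⊢
  exact exists_pow_mul_eq_sq_mul hle this

theorem not_hasPlusCharacter_of_hasMinusCharacter (h : HasMinusCharacter A) :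
    ¬ HasPlusCharacter A := by
  intro hp
  obtain ⟨hr, z, hz, hm⟩ := h
  have hp' : Congr ((1 : F) • A) (normalForm F n ((1 : F) • A).rank 1) := by rwa [one_smul]
  obtain ⟨d, hd⟩ := exists_pow_rank_mul_eq one_ne_zero hr hm hp'
  exact hz ⟨d, by simpa [sq] using hd⟩

theorem not_hasPlusCharacter_smul {z : F} (hz : ¬ IsSquare z) (hr : Odd A.rank)
    (h : HasPlusCharacter A) : ¬ HasPlusCharacter (z • A) := by
  intro h'
  have hz0 : z ≠ 0 := by rintro rfl; exact hz IsSquare.zero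
  obtain ⟨d, hd⟩ := exists_pow_rank_mul_eq hz0 hr.pos h h'
  obtain ⟨k, hk⟩ := hr
  rw [hk, pow_succ, pow_mul'] at hd
  refine hz ⟨d / z ^ k, ?_⟩
  field_simp
  linear_combination hd

theorem hasPlusCharacter_smul [Finite F] (h2 : ringChar F ≠ 2) (hA : A.IsSymm) {z : F}
    (hz : ¬ IsSquare z) (hr : Odd A.rank) (h : HasMinusCharacter A) :
    HasPlusCharacter (z • A) := by
  have hz0 : z ≠ 0 := by rintro rfl; exact hz IsSquare.zero
  have hrk : (z • A).rank = A.rank :=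
    rank_smul_of_mem_nonZeroDivisors _ (mem_nonZeroDivisors_of_ne_zero hz0)
  refine (hasPlusCharacter_or_hasMinusCharacter h2 (hA.smul z)
    (by rw [hrk]; exact hr.pos)).resolve_right ?_
  rintro ⟨-, z₂, hz₂, h₂⟩
  obtain ⟨-, z₁, hz₁, h₁⟩ := h
  obtain ⟨d, hd⟩ := exists_pow_rank_mul_eq hz0 hr.pos h₁ h₂
  have hz₂0 : z₂ ≠ 0 := by rintro rfl; exact hz₂ IsSquare.zero
  have hz₁0 : z₁ ≠ 0 := by rintro rfl; exact hz₁ IsSquare.zero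
  obtain ⟨e, he⟩ := isSquare_mul_of_not_isSquare hz₁ hz₂
  obtain ⟨k, hk⟩ := hr
  rw [hk, pow_succ, pow_mul'] at hd
  have he0 : e ≠ 0 := by rintro rfl; simp_all
  -- Multiplying `z ^ (2k + 1) * z₁ = d² * z₂` by `z₂`, with `z₁ * z₂ = e²`, exhibits `z` as a
  -- square.
  refine hz ⟨d * z₂ / (z ^ k * e), ?_⟩
  field_simp
  linear_combination z₂ * hd - z * (z ^ k) ^ 2 * he

theorem smul_mem_Sym0 {k r : ℕ} {z : F} (hz : z ≠ 0) (h : A ∈ Sym0 F n k r) :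
    z • A ∈ Sym0 F n k r :=
  ⟨h.1.smul z, by
    rw [rank_smul_of_mem_nonZeroDivisors _ (mem_nonZeroDivisors_of_ne_zero hz)]; exact h.2.1,
    fun i hi => by simp [h.2.2 i hi]⟩

theorem sym0Plus_add_sym0Minus [Finite F] (h2 : ringChar F ≠ 2) (n k : ℕ) {r : ℕ} (hr : 0 < r) :
    sym0Plus F n k r + sym0Minus F n k r = sym0 F n k r := by
  rw [sym0Plus, sym0Minus, sym0, ← Set.ncard_union_eq]
  · congr 1
    ext A
    constructor
    · rintro (h | h) <;> exact h.1
    · intro h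
      exact (hasPlusCharacter_or_hasMinusCharacter h2 h.1 (h.2.1.symm ▸ hr)).imp
        (fun h' => ⟨h, h'⟩) fun h' => ⟨h, h'⟩
  · rw [Set.disjoint_left]
    rintro A ⟨-, hp⟩ ⟨-, hm⟩
    exact not_hasPlusCharacter_of_hasMinusCharacter hm hp

theorem sym0Plus_eq_sym0Minus [Finite F] (h2 : ringChar F ≠ 2) (n k : ℕ) {r : ℕ} (hr : Odd r) :
    sym0Plus F n k r = sym0Minus F n k r := by
  have : Fintype F := Fintype.ofFinite F
  obtain ⟨z, hz⟩ := FiniteField.exists_nonsquare h2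
  have hz0 : z ≠ 0 := by rintro rfl; exact hz IsSquare.zero
  have hinj : Function.Injective fun A : Matrix (Fin n) (Fin n) F => z • A :=
    smul_right_injective _ hz0
  apply le_antisymm
  · refine Set.ncard_le_ncard_of_injOn _ (fun A ⟨h, hp⟩ => ?_) hinj.injOn
    have h' := smul_mem_Sym0 hz0 h
    refine ⟨h', (hasPlusCharacter_or_hasMinusCharacter h2 h'.1
      (h'.2.1.symm ▸ hr.pos)).resolve_left ?_⟩
    exact not_hasPlusCharacter_smul hz (h.2.1.symm ▸ hr) hp
  · refine Set.ncard_le_ncard_of_injOn _ (fun A ⟨h, hp⟩ => ?_) hinj.injOn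
    exact ⟨smul_mem_Sym0 hz0 h, hasPlusCharacter_smul h2 h.1 hz (h.2.1.symm ▸ hr) hp⟩

end Character

/-! ### Zeros of quadratic forms of odd rank -/

section Zeros

variable [Fintype F] [DecidableEq F] {ι : Type*} [Fintype ι] [DecidableEq ι]

/-- With `χ` the quadratic character, `a t² = d` has `1 + χ(d a)` solutions, and replacing `a` by `z
a` flips the sign of `χ(d a)`. -/
theorem card_mul_sq_eq_add_card_mul_sq_eq (h2 : ringChar F ≠ 2) {z a : F} (hz : ¬ IsSquare z)
    (ha : a ≠ 0) (d : F) :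
    (Finset.univ.filter fun t : F => a * t ^ 2 = d).card +
      (Finset.univ.filter fun t : F => z * a * t ^ 2 = d).card = 2 := by
  have hz0 : z ≠ 0 := by rintro rfl; exact hz IsSquare.zero
  have key : ∀ a : F, a ≠ 0 → ((Finset.univ.filter fun t : F => a * t ^ 2 = d).card : ℤ) =
      quadraticChar F (d * a) + 1 := by
    intro a ha
    have h1 : quadraticChar F (d * a) = quadraticChar F (d / a) := by
      have : d * a = d / a * a ^ 2 := by field_simp
      rw [this, map_mul, quadraticChar_sq_one' ha, mul_one]
    rw [h1, ← quadraticChar_card_sqrts h2]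
    congr 2
    ext t
    simp [eq_div_iff ha, mul_comm]
  have h := key a ha
  have h' := key (z * a) (mul_ne_zero hz0 ha)
  have : quadraticChar F (d * (z * a)) = - quadraticChar F (d * a) := by
    rw [mul_left_comm, map_mul, quadraticChar_neg_one_iff_not_isSquare.2 hz]; ring
  zify
  rw [h, h', this]; ring

/-- The number of zeros of the diagonal form with coefficients `w`. -/
def zeroCount (w : ι → F) : ℕ := (Finset.univ.filter fun x : ι → F => ∑ i, w i * x i ^ 2 = 0).card

theorem zeroCount_eq_sum (w : ι → F) (i : ι) :
    zeroCount w = ∑ y : {j // j ≠ i} → F,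
      (Finset.univ.filter fun t : F => w i * t ^ 2 = -∑ j, w j.val * y j ^ 2).card := by
  rw [zeroCount, Finset.card_filter, ← (Equiv.funSplitAt i F).symm.sum_comp,
    Fintype.sum_prod_type_right]
  refine Finset.sum_congr rfl fun y _ => ?_
  rw [Finset.card_filter]
  refine Finset.sum_congr rfl fun t _ => ?_
  rw [Fintype.sum_eq_add_sum_subtype_ne _ i]
  have : ∀ j : {j // j ≠ i}, j.val ≠ i := fun j => j.2
  simp [Equiv.funSplitAt, Equiv.piSplitAt, this, eq_neg_iff_add_eq_zero]

/-- Each choice of the other coordinates contributes 2 in total. Hence the excess `q N - q ^ |ι|` of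
the zero count `N` changes sign when `w i` is multiplied by `z`. -/
theorem zeroCount_add_zeroCount_update (h2 : ringChar F ≠ 2) {z : F} (hz : ¬ IsSquare z)
    {w : ι → F} {i : ι} (hi : w i ≠ 0) :
    Fintype.card F * (zeroCount w + zeroCount (Function.update w i (z * w i))) =
      2 * Fintype.card F ^ Fintype.card ι := by
  rw [zeroCount_eq_sum w i, zeroCount_eq_sum _ i, ← Finset.sum_add_distrib]
  have : ∀ j : {j // j ≠ i}, j.val ≠ i := fun j => j.2
  simp only [Function.update_self, ne_eq, this, not_false_eq_true, Function.update_of_ne]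
  simp only [card_mul_sq_eq_add_card_mul_sq_eq h2 hz hi]
  have hc : Fintype.card ι = Fintype.card {j // j ≠ i} + 1 := by
    have : 0 < Fintype.card ι := Fintype.card_pos_iff.2 ⟨i⟩
    simp; omega
  rw [hc]
  simp only [Finset.sum_const, Finset.card_univ, Fintype.card_fun, smul_eq_mul]
  ring

/-- A diagonal form of odd rank has as many zeros as a hyperplane has points. -/
theorem card_mul_zeroCount_of_odd (h2 : ringChar F ≠ 2) {w : ι → F}
    (hw : Odd (Fintype.card {i // w i ≠ 0})) :
    Fintype.card F * zeroCount w = Fintype.card F ^ Fintype.card ι := by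
  obtain ⟨z, hz⟩ := FiniteField.exists_nonsquare h2
  have hz0 : z ≠ 0 := by rintro rfl; exact hz IsSquare.zero
  let E : (ι → F) → ℤ := fun v => Fintype.card F * zeroCount v - Fintype.card F ^ Fintype.card ι
  have key : ∀ S : Finset ι, E (fun i => if i ∈ S then z * w i else w i) =
      (-1) ^ (S.filter fun i => w i ≠ 0).card * E w := by
    intro S
    induction S using Finset.induction_on with
    | empty => simp
    | insert i S hi ih =>
      by_cases h0 : w i = 0
      · rw [Finset.filter_insert, if_neg (by simpa using h0), ← ih]
        congr 1; ext j
        rcases eq_or_ne j i with rfl | hj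
        · simp [h0]
        · simp [hj]
      · rw [Finset.filter_insert, if_pos h0, Finset.card_insert_of_notMem (by simp [hi]), pow_succ,
          mul_neg_one, neg_mul, ← ih]
        have h1 := zeroCount_add_zeroCount_update h2 hz
          (w := fun j => if j ∈ S then z * w j else w j) (i := i) (by simpa [hi] using h0)
        have h3 : (fun j => if j ∈ insert i S then z * w j else w j) = Function.update
            (fun j => if j ∈ S then z * w j else w j) i
            (z * (fun j => if j ∈ S then z * w j else w j) i) := by
          ext j
          rcases eq_or_ne j i with rfl | hj
          · simp [hi]
          · simp [hj]
        rw [← h3] at h1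
        zify at h1
        simp only [E]
        linear_combination h1
  -- Scaling all coefficients by `z` leaves the zeros unchanged but flips the sign of `E` an odd
  -- number of times, so `E w = 0`.
  have h1 := key Finset.univ
  rw [← Fintype.card_subtype, hw.neg_one_pow] at h1
  have h3 : zeroCount (fun i => z * w i) = zeroCount w := by
    simp [zeroCount, mul_assoc, ← Finset.mul_sum, hz0]
  simp only [Finset.mem_univ, if_true, E, h3] at h1
  zify
  linarith

theorem card_mul_card_dotProduct_mulVec_eq_zero (h2 : ringChar F ≠ 2) {B : Matrix ι ι F}
    (hB : B.IsSymm) (hr : Odd B.rank) :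
    Fintype.card F * (Finset.univ.filter fun x : ι → F => x ⬝ᵥ B *ᵥ x = 0).card =
      Fintype.card F ^ Fintype.card ι := by
  obtain ⟨M, w, hM⟩ := exists_eq_mul_diagonal_mul_transpose (Ring.two_ne_zero h2) hB
  have hBw : Congr B (diagonal w) := ⟨M, hM⟩
  rw [hBw.rank_eq, rank_diagonal] at hr
  rw [← card_mul_zeroCount_of_odd h2 hr, zeroCount]
  congr 1
  have hu : IsUnit M.valᵀ := (isUnit_transpose M.val).2 M.isUnit
  refine Finset.card_bij (fun x _ => M.valᵀ *ᵥ x) (fun x hx => ?_)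
    (fun x _ y _ h => Matrix.mulVec_injective_of_isUnit hu h) fun y hy => ?_
  · simp only [Finset.mem_filter, Finset.mem_univ, true_and] at hx ⊢
    rw [← hx, hM, ← mulVec_mulVec, ← mulVec_mulVec, dotProduct_mulVec, ← mulVec_transpose]
    simp only [dotProduct, mulVec_diagonal]
    exact Finset.sum_congr rfl fun i _ => by ring
  · obtain ⟨x, rfl⟩ := (Matrix.mulVec_surjective_iff_isUnit.2 hu) y
    refine ⟨x, ?_, rfl⟩
    simp only [Finset.mem_filter, Finset.mem_univ, true_and] at hy ⊢
    rw [← hy, hM, ← mulVec_mulVec, ← mulVec_mulVec, dotProduct_mulVec, ← mulVec_transpose]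
    simp only [dotProduct, mulVec_diagonal]
    exact Finset.sum_congr rfl fun i _ => by ring

end Zeros

/-! ### Rank of a bordered matrix -/

section Bordered

variable {ι : Type*} [Fintype ι] [DecidableEq ι]

theorem rank_fromCols_replicateCol {m n : Type*} [Fintype m] [Fintype n] (A : Matrix m n F)
    (v : m → F) [Decidable (∃ u, A *ᵥ u = v)] :
    (fromCols A (replicateCol Unit v)).rank = A.rank + if ∃ u, A *ᵥ u = v then 0 else 1 := by
  have h1 : Set.range (fromCols A (replicateCol Unit v)).col = Set.range A.col ∪ {v} := by
    ext x
    constructor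
    · rintro ⟨j | j, rfl⟩
      · exact Or.inl ⟨j, rfl⟩
      · exact Or.inr rfl
    · rintro (⟨j, rfl⟩ | rfl)
      · exact ⟨Sum.inl j, rfl⟩
      · exact ⟨Sum.inr (), rfl⟩
  have h3 : (∃ u, A *ᵥ u = v) ↔ v ∈ Submodule.span F (Set.range A.col) := by
    rw [← Matrix.range_mulVecLin]; rfl
  rw [rank_eq_finrank_span_cols, rank_eq_finrank_span_cols, h1, Submodule.span_union]
  split_ifs with h
  · rw [sup_eq_left.2 ((Submodule.span_singleton_le_iff_mem _ _).2 (h3.1 h)), add_zero]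
  · exact Submodule.finrank_sup_span_singleton (mt h3.2 h)

/-- The symmetric matrix obtained from `B` by adding a row and column `v` and a corner `a`. -/
def bordered (B : Matrix ι ι F) (v : ι → F) (a : F) : Matrix (ι ⊕ Unit) (ι ⊕ Unit) F :=
  fromBlocks B (replicateCol Unit v) (replicateRow Unit v) (fun _ _ => a)

omit [Field F] [Fintype ι] [DecidableEq ι] in
theorem bordered_isSymm {B : Matrix ι ι F} (hB : B.IsSymm) (v : ι → F) (a : F) :
    (bordered B v a).IsSymm :=
  Matrix.IsSymm.fromBlocks hB rfl rfl

omit [DecidableEq ι] in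
open scoped Classical in
-- Appending the row `v` to `B` has, by symmetry, the same effect on rank as appending the column.
-- The last column `(v, a)` then lies in the column span exactly when some `u` has `B u = v` and `v
-- ⬝ u = a`.
theorem rank_bordered {B : Matrix ι ι F} (hB : B.IsSymm) (v : ι → F) (a : F) :
    (bordered B v a).rank = B.rank + (if ∃ u, B *ᵥ u = v then 0 else 1) +
      if ∃ u, B *ᵥ u = v ∧ v ⬝ᵥ u = a then 0 else 1 := by
  have h1 : bordered B v a = fromCols (fromRows B (replicateRow Unit v))
      (replicateCol Unit (Sum.elim v fun _ => a)) := by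
    ext (i | i) (j | j) <;> rfl
  have h2 : (fromRows B (replicateRow Unit v)).rank = (fromCols B (replicateCol Unit v)).rank := by
    rw [← rank_transpose, transpose_fromRows, hB.eq, transpose_replicateRow]
  rw [h1, rank_fromCols_replicateCol, h2, rank_fromCols_replicateCol]
  congr 2
  refine propext (exists_congr fun u => ?_)
  rw [fromRows_mulVec, Sum.elim_eq_iff, funext_iff (f := replicateRow Unit v *ᵥ u)]
  exact and_congr_right fun _ => ⟨fun h => h (), fun h _ => h⟩

end Bordered

/-! ### Counting borders and imposing diagonal zeros -/

section Counting

variable [Fintype F] [DecidableEq F] {ι : Type*} [Fintype ι] [DecidableEq ι]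

theorem card_eq_card_mul_of_fiber {α β : Type*} [DecidableEq β] {s : Finset α}
    {t : Finset β} {f : α → β} {m : ℕ} (hf : ∀ a ∈ s, f a ∈ t)
    (h : ∀ b ∈ t, (s.filter fun a => f a = b).card = m) : s.card = t.card * m := by
  rw [Finset.card_eq_sum_card_fiberwise hf]
  exact Finset.sum_const_nat h

theorem card_filter_mulVec_eq (B : Matrix ι ι F) (u₀ : ι → F) :
    (Finset.univ.filter fun u => B *ᵥ u = B *ᵥ u₀).card =
      (Finset.univ.filter fun u => B *ᵥ u = 0).card := by
  refine Finset.card_nbij' (fun u => u - u₀) (fun u => u + u₀) ?_ ?_ ?_ ?_ <;> intro u hu <;>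
    simp_all [mulVec_sub, mulVec_add]

open scoped Classical in
/-- In odd rank, a singular border `(v, a)` has zero corner `a` in a `1 / q` fraction of cases. -/
theorem card_singular_border (h2 : ringChar F ≠ 2) {B : Matrix ι ι F} (hB : B.IsSymm)
    (hr : Odd B.rank) :
    Fintype.card F * (Finset.univ.filter fun v : ι → F => ∃ u, B *ᵥ u = v ∧ v ⬝ᵥ u = 0).card =
      (Finset.univ.filter fun p : (ι → F) × F => ∃ u, B *ᵥ u = p.1 ∧ p.1 ⬝ᵥ u = p.2).card := by
  have hsymm : ∀ u w, (B *ᵥ u) ⬝ᵥ w = u ⬝ᵥ B *ᵥ w := fun u w => by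
    rw [dotProduct_mulVec, ← mulVec_transpose, hB.eq]
  -- Both counts pull back along the `K`-to-one parametrization by `u`: singular borders with zero
  -- corner correspond to zeros of the form, all singular borders to all `u`.
  set K := (Finset.univ.filter fun u => B *ᵥ u = 0).card with hK
  have hKpos : 0 < K := Finset.card_pos.2 ⟨0, by simp⟩
  have hzero := card_mul_card_dotProduct_mulVec_eq_zero h2 hB hr
  have h1 : (Finset.univ.filter fun x : ι → F => x ⬝ᵥ B *ᵥ x = 0).card =
      (Finset.univ.filter fun v : ι → F => ∃ u, B *ᵥ u = v ∧ v ⬝ᵥ u = 0).card * K := by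
    refine card_eq_card_mul_of_fiber (f := fun u => B *ᵥ u) (fun u hu => ?_) fun v hv => ?_
    · simp only [Finset.mem_filter, Finset.mem_univ, true_and] at hu ⊢
      exact ⟨u, rfl, by rw [hsymm, hu]⟩
    · simp only [Finset.mem_filter, Finset.mem_univ, true_and] at hv
      obtain ⟨u₀, rfl, hu₀⟩ := hv
      rw [hK, ← card_filter_mulVec_eq B u₀, Finset.filter_filter]
      congr 1
      ext u
      simp only [Finset.mem_filter, Finset.mem_univ, true_and, and_iff_right_iff_imp]
      intro h
      rw [h, ← hsymm, h, hu₀]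
  have h3 : (Finset.univ : Finset (ι → F)).card =
      (Finset.univ.filter fun p : (ι → F) × F =>
        ∃ u, B *ᵥ u = p.1 ∧ p.1 ⬝ᵥ u = p.2).card * K := by
    refine card_eq_card_mul_of_fiber (f := fun u => (B *ᵥ u, (B *ᵥ u) ⬝ᵥ u))
      (fun u _ => ?_) fun v hv => ?_
    · simp only [Finset.mem_filter, Finset.mem_univ, true_and]
      exact ⟨u, rfl, rfl⟩
    · obtain ⟨v, a⟩ := v
      simp only [Finset.mem_filter, Finset.mem_univ, true_and] at hv
      obtain ⟨u₀, rfl, rfl⟩ := hv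
      rw [hK, ← card_filter_mulVec_eq B u₀]
      congr 1
      ext u
      simp only [Finset.mem_filter, Finset.mem_univ, true_and, Prod.mk.injEq,
        and_iff_left_iff_imp]
      intro h
      rw [h, hsymm, h, ← hsymm]
  refine Nat.eq_of_mul_eq_mul_right hKpos ?_
  rw [mul_assoc, ← h1, ← h3, hzero, Finset.card_univ, Fintype.card_fun]

theorem card_border (h2 : ringChar F ≠ 2) {B : Matrix ι ι F} (hB : B.IsSymm) (s : ℕ) :
    Fintype.card F * (Finset.univ.filter fun v : ι → F => (bordered B v 0).rank / 2 = s).card =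
      (Finset.univ.filter fun p : (ι → F) × F => (bordered B p.1 p.2).rank / 2 = s).card := by
  classical
  rcases Nat.even_or_odd B.rank with he | ho
  -- From even rank, increments 0 and 1 have the same half, and increment 2 occurs independently of
  -- `a`.
  · have h : ∀ v a, (bordered B v a).rank / 2 = (bordered B v 0).rank / 2 := by
      intro v a
      obtain ⟨k, hk⟩ := he
      rw [rank_bordered hB, rank_bordered hB, hk]
      by_cases hv : ∃ u, B *ᵥ u = v
      · rw [if_pos hv]
        split_ifs <;> omega
      · have h' : ∀ a, ¬ ∃ u, B *ᵥ u = v ∧ v ⬝ᵥ u = a := fun a ⟨u, hu, _⟩ => hv ⟨u, hu⟩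
        rw [if_neg (h' _), if_neg (h' _)]
    have : (Finset.univ.filter fun p : (ι → F) × F => (bordered B p.1 p.2).rank / 2 = s) =
        (Finset.univ.filter fun v : ι → F => (bordered B v 0).rank / 2 = s) ×ˢ Finset.univ := by
      ext ⟨v, a⟩
      simp [h v a]
    rw [this, Finset.card_product, Finset.card_univ, mul_comm]
  -- From odd rank, increments 1 and 2 both raise the half by one, so only increment 0 is
  -- distinguished.
  · have h : ∀ v a, (bordered B v a).rank / 2 = s ↔
        if ∃ u, B *ᵥ u = v ∧ v ⬝ᵥ u = a then B.rank / 2 = s else B.rank / 2 + 1 = s := by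
      intro v a
      obtain ⟨k, hk⟩ := ho
      rw [rank_bordered hB, hk]
      by_cases hR : ∃ u, B *ᵥ u = v ∧ v ⬝ᵥ u = a
      · have hv : ∃ u, B *ᵥ u = v := hR.imp fun u hu => hu.1
        simp [hR, hv]
      · rw [if_neg hR, if_neg hR]
        split_ifs <;> omega
    have hc := card_singular_border h2 hB ho
    simp only [h]
    by_cases h0 : B.rank / 2 = s
    · have h1 : B.rank / 2 + 1 ≠ s := by omega
      simpa [h0] using hc
    by_cases h1 : B.rank / 2 + 1 = s
    · simp only [h0, h1, if_false_left, and_true]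
      -- Here the nonsingular borders are counted; they are complements of sets already in ratio `1
      -- : q`.
      have e1 := Finset.card_filter_add_card_filter_not (s := (Finset.univ : Finset (ι → F)))
        (fun v : ι → F => ∃ u, B *ᵥ u = v ∧ v ⬝ᵥ u = 0)
      have e2 := Finset.card_filter_add_card_filter_not (s := (Finset.univ : Finset ((ι → F) × F)))
        (fun p => ∃ u, B *ᵥ u = p.1 ∧ p.1 ⬝ᵥ u = p.2)
      rw [Finset.card_univ] at e1 e2
      rw [Fintype.card_prod, ← e1, mul_comm, mul_add, hc] at e2
      exact (Nat.add_left_cancel e2).symm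
    · simp [h0, h1]

/-- The symmetric matrices of rank `2 * s` or `2 * s + 1` with zero diagonal on `Z`. -/
noncomputable def pairSet (F : Type*) [Field F] [Fintype F] [DecidableEq F] (Z : Finset ι) (s : ℕ) :
    Finset (Matrix ι ι F) :=
  Finset.univ.filter fun A => A.IsSymm ∧ A.rank / 2 = s ∧ ∀ i ∈ Z, A i i = 0

theorem mem_pairSet {Z : Finset ι} {s : ℕ} {A : Matrix ι ι F} :
    A ∈ pairSet F Z s ↔ A.IsSymm ∧ A.rank / 2 = s ∧ ∀ i ∈ Z, A i i = 0 := by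
  simp [pairSet]

omit [Field F] [Fintype F] [DecidableEq F] [Fintype ι] [DecidableEq ι] in
theorem bordered_toBlocks {A : Matrix (ι ⊕ Unit) (ι ⊕ Unit) F} (hA : A.IsSymm) :
    bordered A.toBlocks₁₁ (fun i => A (Sum.inl i) (Sum.inr ())) (A (Sum.inr ()) (Sum.inr ())) =
      A := by
  ext (i | i) (j | j)
  · rfl
  · rfl
  · exact hA.apply _ _
  · rfl

omit [Field F] [Fintype F] [DecidableEq F] [Fintype ι] [DecidableEq ι] in
theorem bordered_injective {B : Matrix ι ι F} {v v' : ι → F} {a a' : F}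
    (h : bordered B v a = bordered B v' a') : v = v' ∧ a = a' :=
  ⟨funext fun i => congrFun (congrFun h (Sum.inl i)) (Sum.inr ()),
    congrFun (congrFun h (Sum.inr ())) (Sum.inr ())⟩

/-- Both sets are fibred over the leading block `B`, and `card_border` compares the fibres. -/
theorem card_pairSet_insert_inr (h2 : ringChar F ≠ 2) (Z : Finset ι) (s : ℕ) :
    Fintype.card F * (pairSet F (insert (Sum.inr ()) (Z.map Function.Embedding.inl) :
      Finset (ι ⊕ Unit)) s).card =
      (pairSet F (Z.map Function.Embedding.inl : Finset (ι ⊕ Unit)) s).card := by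
  let t : Finset (Matrix ι ι F) := Finset.univ.filter fun B => B.IsSymm ∧ ∀ i ∈ Z, B i i = 0
  have hmap : ∀ A : Matrix (ι ⊕ Unit) (ι ⊕ Unit) F,
      A ∈ pairSet F (Z.map Function.Embedding.inl : Finset (ι ⊕ Unit)) s → A.toBlocks₁₁ ∈ t := by
    intro A hA
    rw [mem_pairSet] at hA
    simp only [t, Finset.mem_filter, Finset.mem_univ, true_and]
    exact ⟨Matrix.IsSymm.ext fun i j => hA.1.apply _ _,
      fun i hi => hA.2.2 _ (Finset.mem_map_of_mem _ hi)⟩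
  have hsub : pairSet F (insert (Sum.inr ()) (Z.map Function.Embedding.inl) :
      Finset (ι ⊕ Unit)) s ⊆ pairSet F (Z.map Function.Embedding.inl) s := by
    intro A hA
    rw [mem_pairSet] at hA ⊢
    exact ⟨hA.1, hA.2.1, fun i hi => hA.2.2 i (Finset.mem_insert_of_mem hi)⟩
  rw [Finset.card_eq_sum_card_fiberwise (t := t) (f := fun A => A.toBlocks₁₁)
      (fun A hA => hmap A (hsub hA)),
    Finset.card_eq_sum_card_fiberwise (t := t) (f := fun A => A.toBlocks₁₁)
      (fun A hA => hmap A hA), Finset.mul_sum]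
  refine Finset.sum_congr rfl fun B hB => ?_
  simp only [t, Finset.mem_filter, Finset.mem_univ, true_and] at hB
  have hmem : ∀ v a, (bordered B v a).rank / 2 = s →
      bordered B v a ∈ pairSet F (Z.map Function.Embedding.inl : Finset (ι ⊕ Unit)) s := by
    intro v a h
    rw [mem_pairSet]
    refine ⟨bordered_isSymm hB.1 v a, h, fun i hi => ?_⟩
    obtain ⟨j, hj, rfl⟩ := Finset.mem_map.1 hi
    exact hB.2 j hj
  have e1 : (Finset.univ.filter fun v : ι → F => (bordered B v 0).rank / 2 = s).card =
      ((pairSet F (insert (Sum.inr ()) (Z.map Function.Embedding.inl) :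
        Finset (ι ⊕ Unit)) s).filter fun A => A.toBlocks₁₁ = B).card := by
    refine Finset.card_bij (fun v _ => bordered B v 0) (fun v hv => ?_)
      (fun v _ v' _ h => (bordered_injective h).1) fun A hA => ?_
    · simp only [Finset.mem_filter, Finset.mem_univ, true_and] at hv ⊢
      have := mem_pairSet.1 (hmem v 0 hv)
      refine ⟨mem_pairSet.2 ⟨this.1, this.2.1, fun i hi => ?_⟩, rfl⟩
      rcases Finset.mem_insert.1 hi with rfl | hi
      · rfl
      · exact this.2.2 i hi
    · rw [Finset.mem_filter, mem_pairSet] at hA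
      obtain ⟨⟨hs, hr, hz⟩, rfl⟩ := hA
      have := bordered_toBlocks hs
      rw [hz _ (Finset.mem_insert_self _ _)] at this
      exact ⟨_, by simpa only [Finset.mem_filter, Finset.mem_univ, true_and, this] using hr, this⟩
  have e2 : (Finset.univ.filter fun p : (ι → F) × F => (bordered B p.1 p.2).rank / 2 = s).card =
      ((pairSet F (Z.map Function.Embedding.inl : Finset (ι ⊕ Unit)) s).filter
        fun A => A.toBlocks₁₁ = B).card := by
    refine Finset.card_bij (fun p _ => bordered B p.1 p.2) (fun p hp => ?_)
      (fun p _ p' _ h => Prod.ext (bordered_injective h).1 (bordered_injective h).2) fun A hA => ?_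
    · simp only [Finset.mem_filter, Finset.mem_univ, true_and] at hp ⊢
      exact ⟨hmem _ _ hp, rfl⟩
    · rw [Finset.mem_filter, mem_pairSet] at hA
      obtain ⟨⟨hs, hr, hz⟩, rfl⟩ := hA
      have := bordered_toBlocks hs
      exact ⟨(_, _), by
        simpa only [Finset.mem_filter, Finset.mem_univ, true_and, this] using hr, this⟩
  rw [← e1, ← e2, card_border h2 hB.1]

theorem card_pairSet_map {κ : Type*} [Fintype κ] [DecidableEq κ] (e : ι ≃ κ) (Z : Finset ι)
    (s : ℕ) : (pairSet F (Z.map e.toEmbedding) s).card = (pairSet F Z s).card := by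
  refine Finset.card_equiv (Matrix.reindex e.symm e.symm) fun A => ?_
  rw [mem_pairSet, mem_pairSet, rank_reindex]
  refine and_congr ⟨fun h => h.submatrix _, fun h => ?_⟩ (and_congr_right fun _ => ?_)
  · simpa using h.submatrix e.symm
  · simp [← e.forall_congr_right (q := fun i => e.symm i ∈ Z → A i i = 0)]

/-- Relabelling rows and columns together preserves rank, so `i` may be taken as the border index.
-/
theorem card_pairSet_insert (h2 : ringChar F ≠ 2) {Z : Finset ι} {i : ι} (hi : i ∉ Z) (s : ℕ) :
    Fintype.card F * (pairSet F (insert i Z) s).card = (pairSet F Z s).card := by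
  let e : {j // j ≠ i} ⊕ Unit ≃ ι :=
    (Equiv.optionEquivSumPUnit _).symm.trans (Equiv.optionSubtypeNe i)
  have hl : ∀ j, e (Sum.inl j) = j.val := fun j => by simp [e]
  have hr : e (Sum.inr ()) = i := by simp [e]
  have hZ : Z = ((Z.subtype fun j => j ≠ i).map Function.Embedding.inl).map e.toEmbedding := by
    ext j
    simp only [Finset.mem_map, Finset.mem_subtype]
    constructor
    · intro hj
      exact ⟨_, ⟨⟨j, fun h => hi (h ▸ hj)⟩, hj, rfl⟩, hl _⟩
    · rintro ⟨_, ⟨k, hk, rfl⟩, rfl⟩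
      exact (hl k).symm ▸ hk
  have hiZ : insert i Z = (insert (Sum.inr ()) ((Z.subtype fun j => j ≠ i).map
      Function.Embedding.inl)).map e.toEmbedding := by
    rw [Finset.map_insert, ← hZ, Equiv.coe_toEmbedding, hr]
  rw [hiZ, card_pairSet_map, card_pairSet_insert_inr h2, ← card_pairSet_map e, ← hZ]

theorem card_pow_mul_card_pairSet (h2 : ringChar F ≠ 2) (Z : Finset ι) (s : ℕ) :
    Fintype.card F ^ Z.card * (pairSet F Z s).card = (pairSet F (∅ : Finset ι) s).card := by
  induction Z using Finset.induction_on with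
  | empty => simp
  | insert i Z hi ih =>
    rw [Finset.card_insert_of_notMem hi, pow_succ, mul_assoc, card_pairSet_insert h2 hi, ih]

end Counting

/-! ### Return to the counts for `Fin n` -/

theorem sym_eq_sym0_zero (F : Type*) [Field F] (n r : ℕ) : sym F n r = sym0 F n 0 r := by
  simp [sym, sym0, Sym, Sym0]

theorem sym0_add_sym0 [Fintype F] [DecidableEq F] (n k s : ℕ) :
    sym0 F n k (2 * s) + sym0 F n k (2 * s + 1) =
      (pairSet F (Finset.univ.filter fun i : Fin n => i.val < k) s).card := by
  rw [sym0, sym0, ← Set.ncard_union_eq, ← Set.ncard_coe_finset]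
  · congr 1
    ext A
    simp only [Set.mem_union, Sym0, Set.mem_ofPred_eq, Finset.mem_coe, mem_pairSet,
      Finset.mem_filter, Finset.mem_univ, true_and]
    have : A.rank / 2 = s ↔ A.rank = 2 * s ∨ A.rank = 2 * s + 1 := by omega
    rw [this]
    tauto
  · rw [Set.disjoint_left]
    rintro A ⟨-, h, -⟩ ⟨-, h', -⟩
    omega

end SymRank

theorem mainTheorem11 (F : Type*) [Field F] [Finite F] (q : ℕ) (hq : Nat.card F = q)
    (hodd : Odd q) (n k s : ℕ) (hk : k ≤ n) :
    (SymRank.sym0Plus F (n + 1) (k + 1) (2 * s + 1) =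
        SymRank.sym0Minus F (n + 1) (k + 1) (2 * s + 1) ∧
      (SymRank.sym0Minus F (n + 1) (k + 1) (2 * s + 1) : ℚ) =
        1 / 2 * (SymRank.sym0 F (n + 1) (k + 1) (2 * s + 1) : ℚ)) ∧
    (SymRank.sym0 F (n + 1) (k + 1) (2 * s) : ℚ) +
        (SymRank.sym0 F (n + 1) (k + 1) (2 * s + 1) : ℚ) =
      1 / (q : ℚ) ^ (k + 1) *
        ((SymRank.sym F (n + 1) (2 * s) : ℚ) + (SymRank.sym F (n + 1) (2 * s + 1) : ℚ)) := by
  classical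
  have := Fintype.ofFinite F
  rw [Nat.card_eq_fintype_card] at hq
  have h2 : ringChar F ≠ 2 := by
    intro h
    have := FiniteField.even_card_of_char_two h
    rw [hq] at this
    exact Nat.not_even_iff_odd.2 hodd (Nat.even_iff.2 this)
  have hpm := SymRank.sym0Plus_eq_sym0Minus h2 (n + 1) (k + 1) (odd_two_mul_add_one s)
  refine ⟨⟨hpm, ?_⟩, ?_⟩
  · have h := SymRank.sym0Plus_add_sym0Minus h2 (n + 1) (k + 1)
      (odd_two_mul_add_one s).pos
    rw [hpm] at h
    rw [← h]
    push_cast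
    ring
  · have hq0 : (q : ℚ) ≠ 0 := by
      rintro h
      rw [Nat.cast_eq_zero.1 h] at hodd
      exact absurd hodd (by decide)
    have h := SymRank.card_pow_mul_card_pairSet h2
      (Finset.univ.filter fun i : Fin (n + 1) => i.val < k + 1) s
    have h0 : (∅ : Finset (Fin (n + 1))) = Finset.univ.filter fun i => i.val < 0 := by simp
    -- Since `k ≤ n`, exactly `k + 1` diagonal positions are constrained, which gives the exponent.
    rw [h0, ← SymRank.sym0_add_sym0, ← SymRank.sym0_add_sym0, Fin.card_filter_val_lt,
      min_eq_right (by omega), hq, ← SymRank.sym_eq_sym0_zero, ← SymRank.sym_eq_sym0_zero] at h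
    have h' : (q : ℚ) ^ (k + 1) * (SymRank.sym0 F (n + 1) (k + 1) (2 * s) +
        SymRank.sym0 F (n + 1) (k + 1) (2 * s + 1)) =
        SymRank.sym F (n + 1) (2 * s) + SymRank.sym F (n + 1) (2 * s + 1) := by
      exact_mod_cast h
    rw [← h']
    field_simp
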